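/- Let $R$ be a commutative ring with identity and let $M$ be a nonzero $R$-module. For a finite sequence ${\bf x}=x_1,\dots,x_\ell$ in $R$ write $\ell({\bf x})=\ell$ and ${\bf x}^n=x_1^n,\dots,x_\ell^n$; let $H_i({\bf x},M)$ be the homology of the Koszul complex $K_\bullet({\bf x},M)=K_\bullet(x_1,R)\otimes_R\cdots\otimes_R K_\bullet(x_\ell,R)\otimes_R M$, and let $H^i_{\bf x}(M)$ be the cohomology of the Čech complex $C(x_1)\otimes_R\cdots\otimes_R C(x_\ell)\otimes_R M$, where $C(x)$ is $0\to R\to R_x\to 0$. The sequence ${\bf x}$ is called *$M$-weakly proregular* if for each $n$ there is $m\ge n$ such that the map $H_i({\bf x}^m,M)\to H_i({\bf x}^n,M)$ is zero for all $i\ge1$; this map is induced by the tensor product over $j$ of the chain maps $K_\bullet(x_j^m,R)\to K_\bullet(x_j^n,R)$ that are multiplication by $x_j^{m-n}$ in degree $1$ and the identity in degree $0$. It is a *parameter sequence on $M$* if it is $M$-weakly proregular, ${\bf x}M\ne M$, and $H^{\ell({\bf x})}_{\bf x}(M)_{\mathfrak p}\neq0$ for every prime $\mathfrak p\in\operatorname{Supp}_R(M/{\bf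 x}M)$. It is a *strong parameter sequence on $M$* if $x_1,\dots,x_i$ is a parameter sequence on $M$ for each $i=1,\dots,\ell({\bf x})$ (in particular, the empty sequence is one). A sequence ${\bf x}$ is *weak $M$-regular* if $x_i$ is a non-zero-divisor on $M/(x_1,\dots,x_{i-1})M$ for $i=1,\dots,\ell$, and *$M$-regular* if moreover ${\bf x}M\neq M$. For an ideal $I$ of $R$, $\operatorname{grade}(I,M)\in\mathbb N\cup\{\infty\}$ is the supremum of the lengths of weak $M$-regular sequences contained in $I$, and $$\operatorname{p-grade}_R(I,M)=\lim_{m\to\infty}\operatorname{grade}\bigl(IR[t_1,\dots,t_m],\,R[t_1,\dots,t_m]\otimes_R M\bigr).$$ Then the following are equivalent: 1. $M$ is Cohen-Macaulay, i.e. every strong parameter sequence on $M$ is an $M$-regular sequence. 2. $\operatorname{grade}({\bf x}R,M)=\ell({\bf x})$ for every strong parameter sequence ${\bf x}$ on $M$. 3. $\operatorname{p-grade}_R({\bf x}R,M)=\ell({\bf x})$ for every strong parameter sequence ${\bf x}$ on $M$. 4. $H_i({\bf x},M)=0$ for all $i\ge1$ and every strong parameter sequence ${\bf x}$ on $M$.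 5. $H^i_{\bf x}(M)=0$ for all $i<\ell({\bf x})$ and every strong parameter sequence ${\bf x}$ on $M$. -/

import Mathlib

open CategoryTheory Filter Topology
open scoped TensorProduct

noncomputable section

namespace NonNoethCM

universe u v

variable {R : Type u} [CommRing R] {l : ℕ}

/-- The subsets of `{0, …, l - 1}` with exactly `i` elements. -/
abbrev Idx (l i : ℕ) : Type := {S : Finset (Fin l) // S.card = i}

/-- `(-1) ^ #{k ∈ S | k < j}`. -/
def sgn (S : Finset (Fin l)) (j : Fin l) : ℤ :=
  (-1) ^ (S.filter (· < j)).card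

lemma sgn_insert (S : Finset (Fin l)) {j : Fin l} (hj : j ∉ S) (k : Fin l) :
    sgn (insert j S) k = (if j < k then -1 else 1) * sgn S k := by
  unfold sgn
  rw [Finset.filter_insert]
  split_ifs with h
  · rw [Finset.card_insert_of_notMem (by simp [hj]), pow_succ']
  · simp

lemma sgn_swap (S : Finset (Fin l)) {j k : Fin l} (hj : j ∉ S) (hk : k ∉ S) (hjk : j ≠ k) :
    sgn S j * sgn (insert j S) k + sgn S k * sgn (insert k S) j = 0 := by
  rw [sgn_insert S hj, sgn_insert S hk]
  rcases lt_or_gt_of_ne hjk with h | h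
  · rw [if_pos h, if_neg h.not_gt]; ring
  · rw [if_neg h.not_gt, if_pos h]; ring

/-! ### The Koszul complex -/

/-- Adding an element to an index set. -/
def Idx.insert {i : ℕ} (S : Idx l i) (j : {j : Fin l // j ∉ S.1}) : Idx l (i + 1) :=
  ⟨Insert.insert j.1 S.1, by rw [Finset.card_insert_of_notMem j.2, S.2]⟩

/-- The Koszul differential. A chain `f` of degree `i` stands for `∑ f S e_S` over the subsets
`S` of size `i`; the map is `e_T ↦ ∑_{j ∈ T} (-1) ^ #{k ∈ T | k < j} x_j e_{T \ j}`. -/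
def koszulD (x : Fin l → R) (M : Type v) [AddCommGroup M] [Module R M] (i : ℕ) :
    (Idx l (i + 1) → M) →ₗ[R] (Idx l i → M) :=
  LinearMap.pi fun S => ∑ j : {j : Fin l // j ∉ S.1},
    ((sgn S.1 j.1 : R) • x j.1 • LinearMap.proj (R := R) (φ := fun _ : Idx l (i + 1) => M) (S.insert j))

section Koszul

variable (x : Fin l → R) (M : Type v) [AddCommGroup M] [Module R M]

lemma koszulD_apply (i : ℕ) (f : Idx l (i + 1) → M) (S : Idx l i) :
    koszulD x M i f S =
      ∑ j : {j : Fin l // j ∉ S.1}, (sgn S.1 j.1 : R) • x j.1 • f (S.insert j) := by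
  simp [koszulD]

lemma koszulD_comp (i : ℕ) : koszulD x M i ∘ₗ koszulD x M (i + 1) = 0 := by
  refine LinearMap.ext fun f => funext fun S => ?_
  simp only [LinearMap.comp_apply, koszulD_apply, Finset.smul_sum, LinearMap.zero_apply,
    Pi.zero_apply]
  rw [Finset.sum_sigma']
  have key : ∀ a : (Σ j : {j : Fin l // j ∉ S.1}, {k : Fin l // k ∉ (S.insert j).1}),
      a.2.1 ≠ a.1.1 ∧ a.2.1 ∉ S.1 := fun a => by
    have := a.2.2
    simpa [Idx.insert] using this
  refine Finset.sum_involution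
    (fun a _ => ⟨⟨a.2.1, (key a).2⟩, ⟨a.1.1, by
      simp only [Idx.insert, Finset.mem_insert, not_or]
      exact ⟨(key a).1.symm, a.1.2⟩⟩⟩) ?_ ?_ ?_ ?_
  · intro a _
    have e : ((S.insert ⟨a.2.1, (key a).2⟩).insert ⟨a.1.1, by
        simp only [Idx.insert, Finset.mem_insert, not_or]
        exact ⟨(key a).1.symm, a.1.2⟩⟩) = (S.insert a.1).insert a.2 :=
      Subtype.ext (Finset.insert_comm _ _ _)
    have h := sgn_swap S.1 a.1.2 (key a).2 (key a).1.symm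
    rw [e]
    simp only [Idx.insert, smul_smul]
    rw [← add_smul]
    have h' := congrArg (fun z : ℤ => (z : R) * (x a.1.1 * x a.2.1)) h
    push_cast at h'
    convert zero_smul R _
    linear_combination h'
  · intro a _ _ h
    exact (key a).1 (congrArg (fun b => b.1.1) h)
  · intro a _
    simp
  · intro a _
    rfl

/-- The Koszul complex `K_•(x, M)`. -/
def koszul : ChainComplex (ModuleCat.{v} R) ℕ :=
  ChainComplex.of (fun i => ModuleCat.of R (Idx l i → M))
    (fun i => ModuleCat.ofHom (koszulD x M i)) fun i => by
      rw [← ModuleCat.ofHom_comp, koszulD_comp]; rfl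

/-- The degree `i` component of `K_•(x ^ m, M) ⟶ K_•(x ^ n, M)`; on the summand of `e_S` it is
multiplication by `∏_{j ∈ S} x_j ^ (m - n)`. -/
def koszulPowMap (m n i : ℕ) : (Idx l i → M) →ₗ[R] (Idx l i → M) :=
  LinearMap.pi fun S => (∏ j ∈ S.1, x j ^ (m - n)) •
    LinearMap.proj (R := R) (φ := fun _ : Idx l i => M) S

lemma koszulPowMap_comm {m n : ℕ} (h : n ≤ m) (i : ℕ) :
    koszulD (fun j => x j ^ n) M i ∘ₗ koszulPowMap x M m n (i + 1) =
      koszulPowMap x M m n i ∘ₗ koszulD (fun j => x j ^ m) M i := by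
  refine LinearMap.ext fun f => funext fun S => ?_
  simp only [LinearMap.comp_apply, koszulD_apply, koszulPowMap, LinearMap.pi_apply,
    LinearMap.smul_apply, LinearMap.proj_apply, Finset.smul_sum]
  refine Finset.sum_congr rfl fun j _ => ?_
  simp only [Idx.insert, smul_smul, Finset.prod_insert j.2]
  congr 1
  have e : x j.1 ^ n * x j.1 ^ (m - n) = x j.1 ^ m := by rw [← pow_add, Nat.add_sub_cancel' h]
  linear_combination ((sgn S.1 j.1 : R) * ∏ k ∈ S.1, x k ^ (m - n)) * e

/-- The chain map `φ_n^m : K_•(x ^ m, M) ⟶ K_•(x ^ n, M)` for `n ≤ m`. -/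
def koszulTransition {m n : ℕ} (h : n ≤ m) :
    koszul (fun j => x j ^ m) M ⟶ koszul (fun j => x j ^ n) M :=
  ChainComplex.ofHom (fun i => ModuleCat.ofHom (koszulPowMap x M m n i)) fun i => by
    simp only [koszul, ChainComplex.of_d]
    exact congrArg ModuleCat.ofHom (koszulPowMap_comm x M h i)

/-- `x` is `M`-weakly proregular: for each `n` there is `m ≥ n` such that
`H_i(x ^ m, M) ⟶ H_i(x ^ n, M)` is zero for all `i ≥ 1`. -/
def IsWeaklyProregular : Prop :=
  ∀ n : ℕ, ∃ (m : ℕ) (h : n ≤ m), ∀ i : ℕ, 1 ≤ i →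
    HomologicalComplex.homologyMap (koszulTransition x M h) i = 0

end Koszul

/-! ### The Čech complex -/

section Cech

variable (x : Fin l → R) (M : Type v) [AddCommGroup M] [Module R M]

/-- The localization `M_{x_S}`, where `x_S` is the product of the `x_j` with `j ∈ S`. -/
abbrev LocAt (S : Finset (Fin l)) : Type (max u v) :=
  LocalizedModule (Submonoid.powers (∏ j ∈ S, x j)) M

lemma isUnit_locAt {S T : Finset (Fin l)} (h : S ⊆ T)
    (s : Submonoid.powers (∏ j ∈ S, x j)) :
    IsUnit (algebraMap R (Module.End R (LocAt x M T)) s) := by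
  obtain ⟨s, n, rfl⟩ := s
  have hT := IsLocalizedModule.map_units
    (LocalizedModule.mkLinearMap (Submonoid.powers (∏ j ∈ T, x j)) M)
    ⟨∏ j ∈ T, x j, Submonoid.mem_powers _⟩
  have hd : algebraMap R (Module.End R (LocAt x M T)) (∏ j ∈ T, x j) =
      algebraMap R _ (∏ j ∈ S, x j) * algebraMap R _ (∏ j ∈ T \ S, x j) := by
    rw [← map_mul, mul_comm, Finset.prod_sdiff h]
  have hc : Commute (algebraMap R (Module.End R (LocAt x M T)) (∏ j ∈ S, x j))
      (algebraMap R _ (∏ j ∈ T \ S, x j)) := Algebra.commutes _ _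
  rw [hd] at hT
  have := (hc.isUnit_mul_iff.mp hT).1.pow n
  simpa only [map_pow] using this

/-- The localization map `M_{x_S} → M_{x_T}` for `S ⊆ T`. -/
def locMap {S T : Finset (Fin l)} (h : S ⊆ T) : LocAt x M S →ₗ[R] LocAt x M T :=
  LocalizedModule.lift _ (LocalizedModule.mkLinearMap _ M) (isUnit_locAt x M h)

lemma locMap_mk {S T : Finset (Fin l)} (h : S ⊆ T) :
    locMap x M h ∘ₗ LocalizedModule.mkLinearMap _ M = LocalizedModule.mkLinearMap _ M :=
  LocalizedModule.lift_comp _ _ _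

lemma locMap_comp {S T U : Finset (Fin l)} (h : S ⊆ T) (h' : T ⊆ U) :
    locMap x M h' ∘ₗ locMap x M h = locMap x M (h.trans h') := by
  refine IsLocalizedModule.ext (Submonoid.powers (∏ j ∈ S, x j))
    (LocalizedModule.mkLinearMap _ M) (isUnit_locAt x M (h.trans h')) ?_
  rw [LinearMap.comp_assoc, locMap_mk, locMap_mk, locMap_mk]

/-- Removing an element from an index set. -/
def Idx.erase {i : ℕ} (S : Idx l (i + 1)) (j : {j : Fin l // j ∈ S.1}) : Idx l i :=
  ⟨S.1.erase j.1, by rw [Finset.card_erase_of_mem j.2, S.2, Nat.add_sub_cancel]⟩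

lemma Idx.erase_subset {i : ℕ} (S : Idx l (i + 1)) (j : {j : Fin l // j ∈ S.1}) :
    (S.erase j).1 ⊆ S.1 :=
  Finset.erase_subset _ _

/-- The Čech differential `∏_{#S = i} M_{x_S} → ∏_{#S = i + 1} M_{x_S}`, with component at `S`
`∑_{j ∈ S} (-1) ^ #{k ∈ S | k < j} (f (S \ j) viewed in M_{x_S})`. -/
def cechD (i : ℕ) :
    (∀ S : Idx l i, LocAt x M S.1) →ₗ[R] (∀ S : Idx l (i + 1), LocAt x M S.1) :=
  LinearMap.pi fun S => ∑ j : {j : Fin l // j ∈ S.1},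
    (sgn S.1 j.1 : R) • (locMap x M (S.erase_subset j) ∘ₗ
      LinearMap.proj (R := R) (φ := fun S : Idx l i => LocAt x M S.1) (S.erase j))

lemma cechD_apply (i : ℕ) (f : ∀ S : Idx l i, LocAt x M S.1) (S : Idx l (i + 1)) :
    cechD x M i f S = ∑ j : {j : Fin l // j ∈ S.1},
      (sgn S.1 j.1 : R) • locMap x M (S.erase_subset j) (f (S.erase j)) := by
  simp only [cechD, LinearMap.pi_apply, LinearMap.sum_apply]
  rfl

lemma sgn_erase_swap (S : Finset (Fin l)) {j k : Fin l} (hj : j ∈ S) (hk : k ∈ S) (hjk : j ≠ k) :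
    sgn S j * sgn (S.erase j) k + sgn S k * sgn (S.erase k) j = 0 := by
  have h1 := sgn_insert (S.erase j) (Finset.notMem_erase j S) k
  have h2 := sgn_insert (S.erase k) (Finset.notMem_erase k S) j
  rw [Finset.insert_erase hj] at h1
  rw [Finset.insert_erase hk] at h2
  rw [h1, h2]
  rcases lt_or_gt_of_ne hjk with h | h
  · rw [if_pos h, if_neg h.not_gt]; ring
  · rw [if_neg h.not_gt, if_pos h]; ring

lemma locMap_congr {i : ℕ} (f : ∀ S : Idx l i, LocAt x M S.1) {S S' : Idx l i} (e : S = S')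
    {T : Finset (Fin l)} (h : S.1 ⊆ T) (h' : S'.1 ⊆ T) :
    locMap x M h (f S) = locMap x M h' (f S') := by
  subst e; rfl

lemma cechD_comp (i : ℕ) : cechD x M (i + 1) ∘ₗ cechD x M i = 0 := by
  refine LinearMap.ext fun f => funext fun S => ?_
  simp only [LinearMap.comp_apply, cechD_apply, map_sum, map_smul, Finset.smul_sum,
    LinearMap.zero_apply, Pi.zero_apply]
  rw [Finset.sum_sigma']
  have key : ∀ a : (Σ j : {j : Fin l // j ∈ S.1}, {k : Fin l // k ∈ (S.erase j).1}),
      a.2.1 ≠ a.1.1 ∧ a.2.1 ∈ S.1 := fun a =>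
    Finset.mem_erase.mp a.2.2
  refine Finset.sum_involution
    (fun a _ => ⟨⟨a.2.1, (key a).2⟩, ⟨a.1.1, by
      simp only [Idx.erase, Finset.mem_erase]
      exact ⟨(key a).1.symm, a.1.2⟩⟩⟩) ?_ ?_ ?_ ?_
  · intro a _
    have hm : a.1.1 ∈ (S.erase ⟨a.2.1, (key a).2⟩).1 := by
      simp only [Idx.erase, Finset.mem_erase]
      exact ⟨(key a).1.symm, a.1.2⟩
    have e : ((S.erase ⟨a.2.1, (key a).2⟩).erase ⟨a.1.1, hm⟩) = (S.erase a.1).erase a.2 :=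
      Subtype.ext Finset.erase_right_comm
    have h := sgn_erase_swap S.1 a.1.2 (key a).2 (key a).1.symm
    simp only [← LinearMap.comp_apply, locMap_comp, smul_smul]
    rw [locMap_congr x M f e _ (((S.erase a.1).erase_subset a.2).trans (S.erase_subset a.1)),
      ← add_smul]
    simp only [Idx.erase]
    rw [← Int.cast_mul, ← Int.cast_mul, ← Int.cast_add, h, Int.cast_zero, zero_smul]
  · intro a _ _ h
    exact (key a).1 (congrArg (fun b => b.1.1) h)
  · intro a _
    simp
  · intro a _
    rfl

/-- The Čech complex `C(x; M)`. -/
def cech : CochainComplex (ModuleCat.{max u v} R) ℕ :=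
  CochainComplex.of (fun i => ModuleCat.of R (∀ S : Idx l i, LocAt x M S.1))
    (fun i => ModuleCat.ofHom (cechD x M i)) fun i => by
      rw [← ModuleCat.ofHom_comp, cechD_comp]; rfl

end Cech

/-! ### Finite sequences, grades and Cohen-Macaulay modules -/

section Main

variable (M : Type v) [AddCommGroup M] [Module R M]

/-- The Koszul homology `H_i(x, M)`. -/
abbrev koszulHomology (xs : List R) (i : ℕ) : ModuleCat.{v} R :=
  (koszul xs.get M).homology i

/-- The Čech cohomology `H^i_x(M)`. -/
abbrev cechCohomology (xs : List R) (i : ℕ) : ModuleCat.{max u v} R :=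
  (cech xs.get M).homology i

/-- `x` is a parameter sequence on `M`. -/
structure IsParameterSequence (xs : List R) : Prop where
  weaklyProregular : IsWeaklyProregular xs.get M
  smul_ne_top : Ideal.ofList xs • (⊤ : Submodule R M) ≠ ⊤
  cech_nontrivial : ∀ p : PrimeSpectrum R,
    p ∈ Module.support R (M ⧸ (Ideal.ofList xs • (⊤ : Submodule R M))) →
      Nontrivial (LocalizedModule p.asIdeal.primeCompl (cechCohomology M xs xs.length))

/-- `x = x_1, …, x_l` is a strong parameter sequence on `M`: each `x_1, …, x_i` with
`1 ≤ i ≤ l` is a parameter sequence. The empty sequence always is one. -/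
def IsStrongParameterSequence (xs : List R) : Prop :=
  ∀ i : ℕ, 1 ≤ i → i ≤ xs.length → IsParameterSequence M (xs.take i)

/-- `M`-regular sequences; the empty sequence counts as regular on every module. -/
def IsRegularSequence (xs : List R) : Prop :=
  xs = [] ∨ RingTheory.Sequence.IsRegular M xs

variable (R) in
/-- `M` is Cohen-Macaulay: every strong parameter sequence on `M` is `M`-regular. -/
def IsCohenMacaulay : Prop :=
  ∀ xs : List R, IsStrongParameterSequence M xs → IsRegularSequence M xs

/-- The classical grade: the supremum of the lengths of the weak `M`-regular sequences
contained in `I`. -/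
def classicalGrade (I : Ideal R) : ℕ∞ :=
  ⨆ (xs : List R) (_ : (∀ r ∈ xs, r ∈ I) ∧ RingTheory.Sequence.IsWeaklyRegular M xs),
    (xs.length : ℕ∞)

/-- The polynomial grade of `I` on `M` is `g`: as `m → ∞`, the classical grade of
`I R[t_1, …, t_m]` on `R[t_1, …, t_m] ⊗ M` tends to `g`. -/
def HasPolynomialGrade (I : Ideal R) (g : ℕ∞) : Prop :=
  Tendsto (fun m : ℕ => classicalGrade (R := MvPolynomial (Fin m) R) (MvPolynomial (Fin m) R ⊗[R] M)
    (I.map (algebraMap R (MvPolynomial (Fin m) R)))) atTop (𝓝 g)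

end Main

end NonNoethCM

end

/-!
Wedging with the basis vector `e_j` is a homotopy showing that `x_j` kills the Koszul homology of
`x`, and the Čech complex becomes contractible once `x_j` is inverted, so every Čech cohomology
class is killed by a power of `x_j`. On the other hand, if `y` is a non-zero-divisor on `M`, the
long exact sequence of `0 → M → M → M / y M → 0` shows that `y` acts injectively on the homology of
`M` wherever the neighbouring homology of `M / y M` vanishes. Taking `y` in `(x)`, respectively
among the `x_j`, both can hold only if the homology is zero, and induction along a weakly regular
sequence yields the vanishing of Koszul homology and Čech cohomology.

Conversely, `H_1(x, M) = 0` puts every coefficient of a relation `∑ x_j m_j = 0` into the submodule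
generated by the multiples of the other elements, so the last element of `x` is a non-zero-divisor
modulo the previous ones. If instead the Čech cohomology vanishes below the top degree and
`x_1, …, x_{l-1}` is weakly regular, the vanishing descends to `H^0` of
`M / (x_1, …, x_{l-1}) M`, where it says that no nonzero element is killed by all of `x`. In both
cases one inducts on the initial segments of `x`.

The polynomial grade fits in because `R[t]` is faithfully flat over `R`, and because `M` is a
retract of `R[t] ⊗ M`, so that vanishing of Koszul homology descends from `R[t]` to `R`.
-/

noncomputable section

namespace NonNoethCM

universe u v

section Signs

variable {l : ℕ}

lemma sgn_mul_self (S : Finset (Fin l)) (j : Fin l) : sgn S j * sgn S j = 1 := by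
  rw [sgn, ← mul_pow, neg_one_mul, neg_neg, one_pow]

lemma sgn_insert_self {S : Finset (Fin l)} {j : Fin l} (hj : j ∉ S) :
    sgn (insert j S) j = sgn S j := by
  rw [sgn_insert S hj, if_neg (lt_irrefl j), one_mul]

lemma sgn_mul_sgn_add_sgn_insert_mul_sgn_insert {S : Finset (Fin l)} {j k : Fin l} (hj : j ∉ S)
    (hk : k ∉ S) (hjk : j ≠ k) :
    sgn S j * sgn S k + sgn (insert j S) k * sgn (insert k S) j = 0 := by
  rw [sgn_insert S hj, sgn_insert S hk]
  rcases lt_or_gt_of_ne hjk with h | h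
  · rw [if_pos h, if_neg h.not_gt]; ring
  · rw [if_neg h.not_gt, if_pos h]; ring

lemma sgn_mul_sgn_erase {S : Finset (Fin l)} {j k : Fin l} (hj : j ∉ S) (hk : k ∈ S) :
    sgn S k * sgn (S.erase k) j = -(sgn S j * sgn (insert j S) k) := by
  obtain ⟨T, hT, rfl⟩ : ∃ T, k ∉ T ∧ insert k T = S :=
    ⟨S.erase k, Finset.notMem_erase k S, Finset.insert_erase hk⟩
  obtain ⟨hjk, hjT⟩ : j ≠ k ∧ j ∉ T := by simpa using hj
  have hkT : k ∉ insert j T := by simp [hjk.symm, hT]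
  rw [Finset.erase_insert hT, sgn_insert_self hT, Finset.insert_comm, sgn_insert_self hkT]
  linear_combination sgn_mul_sgn_add_sgn_insert_mul_sgn_insert hjT hT hjk

lemma Idx.mem_insert {i : ℕ} {S : Idx l i} {j : {j : Fin l // j ∉ S.1}} {k : Fin l} :
    k ∈ (S.insert j).1 ↔ k = j.1 ∨ k ∈ S.1 :=
  Finset.mem_insert

lemma Idx.mem_insert_self {i : ℕ} (S : Idx l i) (j : {j : Fin l // j ∉ S.1}) :
    j.1 ∈ (S.insert j).1 :=
  Finset.mem_insert_self _ _

lemma Idx.mem_insert_of_mem {i : ℕ} {S : Idx l i} {j : {j : Fin l // j ∉ S.1}} {k : Fin l}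
    (hk : k ∈ S.1) : k ∈ (S.insert j).1 :=
  Finset.mem_insert_of_mem hk

lemma Idx.erase_insert {i : ℕ} (S : Idx l i) (j : {j : Fin l // j ∉ S.1}) :
    (S.insert j).erase ⟨j.1, S.mem_insert_self j⟩ = S :=
  Subtype.ext (Finset.erase_insert j.2)

lemma Idx.insert_erase {i : ℕ} (S : Idx l (i + 1)) (j : {j : Fin l // j ∈ S.1}) :
    (S.erase j).insert ⟨j.1, Finset.notMem_erase _ _⟩ = S :=
  Subtype.ext (Finset.insert_erase j.2)

lemma Idx.erase_insert_subset {i : ℕ} (S : Idx l i) {j k : Fin l} (hj : j ∉ S.1)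
    (hk : k ∈ (S.insert ⟨j, hj⟩).1) :
    ((S.insert ⟨j, hj⟩).erase ⟨k, hk⟩).1 ⊆ Insert.insert j S.1 :=
  Finset.erase_subset k (Insert.insert j S.1)

lemma Idx.sum_mem_insert {A : Type*} [AddCommMonoid A] {i : ℕ} (S : Idx l i)
    (j : {j : Fin l // j ∉ S.1}) (φ : {k // k ∈ (S.insert j).1} → A) :
    ∑ k, φ k = φ ⟨j.1, S.mem_insert_self j⟩ +
      ∑ k : {k // k ∈ S.1}, φ ⟨k.1, Idx.mem_insert_of_mem k.2⟩ :=
  ((Finset.subtypeInsertEquivOption j.2).symm.sum_comp φ).symm.trans (Fintype.sum_option _)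

lemma Idx.sum_notMem {A : Type*} [AddCommMonoid A] {i : ℕ} (S : Idx l i)
    (j : {j : Fin l // j ∉ S.1}) (φ : {k // k ∉ S.1} → A) :
    ∑ k, φ k = φ j +
      ∑ k : {k // k ∉ (S.insert j).1}, φ ⟨k.1, fun h => k.2 (Idx.mem_insert_of_mem h)⟩ := by
  rw [Fintype.sum_eq_add_sum_subtype_ne φ j]
  congr 1
  refine Fintype.sum_equiv
    ⟨fun k => ⟨k.1.1, fun h => (Idx.mem_insert.mp h).elim (fun h => k.2 (Subtype.ext h)) k.1.2⟩,
      fun k => ⟨⟨k.1, fun h => k.2 (Idx.mem_insert_of_mem h)⟩,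
        fun h => k.2 (Idx.mem_insert.mpr (.inl (congrArg Subtype.val h)))⟩,
      fun _ => rfl, fun _ => rfl⟩ _ _ fun _ => rfl

end Signs

section Homology

lemma exact_piMap {ι : Type*} {A B C : ι → Type*} [∀ i, Zero (C i)] {f : ∀ i, A i → B i}
    {g : ∀ i, B i → C i} (h : ∀ i, Function.Exact (f i) (g i)) :
    Function.Exact (Pi.map f) (Pi.map g) := fun b => by
  simp only [funext_iff, Set.mem_range, Pi.map_apply, Pi.zero_apply, (h _) _]
  exact Classical.skolem

variable {R : Type u} [CommRing R] {ι : Type*} {c : ComplexShape ι}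

lemma homologyMap_smul_id (C : HomologicalComplex (ModuleCat.{v} R) c) (r : R) (i : ι) :
    HomologicalComplex.homologyMap (r • 𝟙 C) i = r • 𝟙 (C.homology i) := by
  have h := ShortComplex.homologyMap_smul (a := r) (φ := 𝟙 (C.sc i))
  rw [ShortComplex.homologyMap_id] at h
  exact h

lemma isSMulRegular_homology_of_shortExact {C D : HomologicalComplex (ModuleCat.{v} R) c} {r : R}
    {π : C ⟶ D} {w : (r • 𝟙 C) ≫ π = 0} (h : (ShortComplex.mk (r • 𝟙 C) π w).ShortExact) {j : ι}
    (hD : ∀ i, c.Rel i j → Limits.IsZero (D.homology i)) : IsSMulRegular (C.homology j) r := by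
  suffices Mono (HomologicalComplex.homologyMap (r • 𝟙 C) j) by
    rw [homologyMap_smul_id, ModuleCat.mono_iff_injective] at this
    exact this
  by_cases hj : ∃ i, c.Rel i j
  · obtain ⟨i, hij⟩ := hj
    exact (h.homology_exact₁ i j hij).mono_g ((hD i hij).eq_of_src _ _)
  · have := h.mono_f
    exact HomologicalComplex.mono_homologyMap_of_mono_of_not_rel _ j (not_exists.mp hj)

lemma isZero_homology_X₃_of_shortExact {A : Type*} [Category* A] [Abelian A]
    {S : ShortComplex (HomologicalComplex A c)} (h : S.ShortExact) {i j : ι} (hij : c.Rel i j)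
    (hi : Limits.IsZero (S.X₂.homology i)) (hj : Limits.IsZero (S.X₁.homology j)) :
    Limits.IsZero (S.X₃.homology i) :=
  (h.homology_exact₃ i j hij).isZero_X₂ (hi.eq_of_src _ _) (hj.eq_of_tgt _ _)

lemma isZero_of_isSMulRegular {M : ModuleCat.{v} R} {r : R} (hr : IsSMulRegular M r)
    (h : ∀ m : M, ∃ n : ℕ, r ^ n • m = 0) : Limits.IsZero M := by
  refine ModuleCat.isZero_iff_subsingleton.mpr (subsingleton_of_forall_eq 0 fun m => ?_)
  obtain ⟨n, hn⟩ := h m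
  exact (hr.pow n).right_eq_zero_of_smul hn

lemma exists_pow_smul_homology_eq_zero (S : ShortComplex (ModuleCat.{v} R)) {r : R}
    (h : ∀ f : S.X₂, S.g f = 0 → ∃ n : ℕ, r ^ n • f ∈ LinearMap.range S.f.hom)
    (z : S.homology) : ∃ n : ℕ, r ^ n • z = 0 := by
  let e := S.moduleCatHomologyIso.toLinearEquiv
  obtain ⟨⟨f, hf⟩, hfz⟩ := Submodule.mkQ_surjective _ (e z)
  obtain ⟨n, g, hg⟩ := h f hf
  have hfg : Submodule.mkQ S.moduleCatToCycles.range (r ^ n • ⟨f, hf⟩) = 0 :=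
    (Submodule.Quotient.mk_eq_zero _).mpr ⟨g, Subtype.ext hg⟩
  refine ⟨n, e.map_eq_zero_iff.mp ?_⟩
  exact (map_smul e _ _).trans ((congrArg (r ^ n • ·) hfz.symm).trans hfg)

end Homology

section Koszul

variable {R : Type u} [CommRing R] {l : ℕ} (x : Fin l → R)
variable {M : Type v} [AddCommGroup M] [Module R M]

lemma koszulD_apply_eq_sum_zsmul (i : ℕ) (f : Idx l (i + 1) → M) (S : Idx l i) :
    koszulD x M i f S = ∑ j : {j // j ∉ S.1}, sgn S.1 j.1 • x j.1 • f (S.insert j) := by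
  simp only [koszulD_apply, Int.cast_smul_eq_zsmul]

variable (R M) in
/-- Exterior multiplication `e_j ∧ -` on the Koszul complex. -/
def koszulWedge (j : Fin l) (i : ℕ) :
    (Idx l i → M) →ₗ[R] (Idx l (i + 1) → M) :=
  LinearMap.pi fun T => if h : j ∈ T.1 then
    sgn T.1 j • LinearMap.proj (R := R) (φ := fun _ : Idx l i => M) (T.erase ⟨j, h⟩) else 0

lemma koszulWedge_apply_of_mem {i : ℕ} {j : Fin l} (f : Idx l i → M) {T : Idx l (i + 1)}
    (h : j ∈ T.1) : koszulWedge R M j i f T = sgn T.1 j • f (T.erase ⟨j, h⟩) := by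
  simp [koszulWedge, h]

lemma koszulWedge_apply_of_notMem {i : ℕ} {j : Fin l} (f : Idx l i → M) {T : Idx l (i + 1)}
    (h : j ∉ T.1) : koszulWedge R M j i f T = 0 := by
  simp [koszulWedge, h]

lemma koszulWedge_apply_insert {i : ℕ} (f : Idx l i → M) (S : Idx l i) (j : {j // j ∉ S.1}) :
    koszulWedge R M j.1 i f (S.insert j) = sgn S.1 j.1 • f S := by
  rw [koszulWedge_apply_of_mem f (S.mem_insert_self j), S.erase_insert]
  exact congrArg (· • f S) (sgn_insert_self j.2)

lemma koszulD_koszulWedge_apply_of_notMem {i : ℕ} (f : Idx l i → M) {S : Idx l i} {j : Fin l}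
    (hj : j ∉ S.1) : koszulD x M i (koszulWedge R M j i f) S = x j • f S := by
  rw [koszulD_apply_eq_sum_zsmul, Fintype.sum_eq_single ⟨j, hj⟩ fun k hk => ?_]
  · rw [koszulWedge_apply_insert f S ⟨j, hj⟩, smul_comm (x j), smul_smul, sgn_mul_self, one_smul]
  · have hjk : j ∉ (S.insert k).1 := fun h =>
      (Idx.mem_insert.mp h).elim (fun h => hk (Subtype.ext h.symm)) hj
    rw [koszulWedge_apply_of_notMem f hjk, smul_zero, smul_zero]

lemma koszulWedge_koszulD_add_koszulD_koszulWedge {i : ℕ} (j : Fin l) (f : Idx l (i + 1) → M) :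
    koszulWedge R M j i (koszulD x M i f) + koszulD x M (i + 1) (koszulWedge R M j (i + 1) f) =
      x j • f := by
  ext T
  rw [Pi.add_apply, Pi.smul_apply, add_comm]
  by_cases hj : j ∈ T.1
  swap
  · rw [koszulD_koszulWedge_apply_of_notMem x f hj, koszulWedge_apply_of_notMem _ hj, add_zero]
  obtain ⟨S, hS, rfl⟩ : ∃ (S : Idx l i) (hS : j ∉ S.1), S.insert ⟨j, hS⟩ = T :=
    ⟨T.erase ⟨j, hj⟩, Finset.notMem_erase j _, T.insert_erase ⟨j, hj⟩⟩
  rw [koszulWedge_apply_insert _ S ⟨j, hS⟩, koszulD_apply_eq_sum_zsmul, koszulD_apply_eq_sum_zsmul,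
    S.sum_notMem ⟨j, hS⟩, smul_add, smul_smul, sgn_mul_self, one_smul,
    add_left_comm, Finset.smul_sum]
  refine add_eq_left.mpr ?_
  rw [← Finset.sum_add_distrib]
  refine Finset.sum_eq_zero fun k _ => ?_
  obtain ⟨hkj, hkS⟩ : k.1 ≠ j ∧ k.1 ∉ S.1 := not_or.mp (Idx.mem_insert.not.mp k.2)
  have hjk : j ∉ (S.insert ⟨k.1, hkS⟩).1 := by
    simp [Idx.mem_insert, hkj.symm, hS]
  have e : (S.insert ⟨j, hS⟩).insert k = (S.insert ⟨k.1, hkS⟩).insert ⟨j, hjk⟩ :=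
    Subtype.ext (Finset.insert_comm _ _ _)
  rw [e, koszulWedge_apply_insert f _ ⟨j, hjk⟩, smul_comm (x k.1), smul_smul, smul_smul, ← add_smul,
    add_comm]
  have := sgn_mul_sgn_add_sgn_insert_mul_sgn_insert hS hkS hkj.symm
  exact (congrArg (· • x k.1 • f (S.insert ⟨k.1, hkS⟩)) this).trans (zero_smul _ _)

variable (M) in
lemma koszul_d (i : ℕ) : (koszul x M).d (i + 1) i = ModuleCat.ofHom (koszulD x M i) := by
  simp only [koszul, ChainComplex.of_d]

variable (M) in
lemma homologyMap_smul_id_koszul (j : Fin l) (i : ℕ) :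
    HomologicalComplex.homologyMap (x j • 𝟙 (koszul x M)) i = 0 := by
  let wedge (n m : ℕ) (h : n + 1 = m) : (koszul x M).X n ⟶ (koszul x M).X m :=
    ModuleCat.ofHom (koszulWedge R M j n) ≫ eqToHom (congrArg (koszul x M).X h)
  have wedge_succ (n : ℕ) : wedge n (n + 1) rfl = ModuleCat.ofHom (koszulWedge R M j n) :=
    Category.comp_id _
  suffices x j • 𝟙 (koszul x M) = Homotopy.nullHomotopicMap' (fun n m h => wedge n m h) by
    rw [this, (Homotopy.nullHomotopy' _).homologyMap_eq, HomologicalComplex.homologyMap_zero]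
  ext n : 1
  obtain _ | n := n
  · rw [Homotopy.nullHomotopicMap'_f_of_not_rel_left (k₁ := 1) (k₀ := 0) rfl (by simp), koszul_d,
      wedge_succ]
    refine ModuleCat.hom_ext (LinearMap.ext fun f => funext fun S => ?_)
    have hj : j ∉ S.1 := by simp [Finset.card_eq_zero.mp S.2]
    exact (koszulD_koszulWedge_apply_of_notMem x f hj).symm
  · rw [Homotopy.nullHomotopicMap'_f (k₂ := n + 2) (k₁ := n + 1) (k₀ := n) rfl rfl, koszul_d,
      koszul_d, wedge_succ, wedge_succ]
    exact ModuleCat.hom_ext (LinearMap.ext fun f =>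
      (koszulWedge_koszulD_add_koszulD_koszulWedge x j f).symm)

variable (M) in
lemma span_range_le_annihilator_koszul_homology (i : ℕ) :
    Ideal.span (Set.range x) ≤ Module.annihilator R ((koszul x M).homology i) := by
  rw [Ideal.span_le]
  rintro _ ⟨j, rfl⟩
  refine Module.mem_annihilator.mpr fun z => ?_
  have := homologyMap_smul_id_koszul x M j i
  rw [homologyMap_smul_id] at this
  exact LinearMap.congr_fun (congrArg ModuleCat.Hom.hom this) z

lemma koszulD_map {N : Type*} [AddCommGroup N] [Module R N] (φ : M →ₗ[R] N) {i : ℕ}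
    (f : Idx l (i + 1) → M) :
    koszulD x N i (fun S => φ (f S)) = fun S => φ (koszulD x M i f S) := by
  ext S
  simp only [koszulD_apply, map_sum, map_smul]

section Functoriality

variable {N P : Type v} [AddCommGroup N] [Module R N] [AddCommGroup P] [Module R P]

/-- The chain map `K_•(x, M) ⟶ K_•(x, N)` induced by a linear map `M → N`. -/
def koszulMap (φ : M →ₗ[R] N) : koszul x M ⟶ koszul x N :=
  ChainComplex.ofHom (fun i => ModuleCat.ofHom (LinearMap.piMap fun _ : Idx l i => φ)) fun i => by
    rw [koszul_d, koszul_d]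
    exact ModuleCat.hom_ext (LinearMap.ext (koszulD_map x φ))

lemma koszulMap_comp_eq_zero {φ : M →ₗ[R] N} {ψ : N →ₗ[R] P} (h : ψ ∘ₗ φ = 0) :
    koszulMap x φ ≫ koszulMap x ψ = 0 := by
  ext i : 1
  exact ModuleCat.hom_ext (LinearMap.ext fun f => funext fun S => LinearMap.congr_fun h (f S))

lemma koszulMap_shortExact {φ : M →ₗ[R] N} {ψ : N →ₗ[R] P} (hφ : Function.Injective φ)
    (h : Function.Exact φ ψ) (hψ : Function.Surjective ψ) :
    (ShortComplex.mk (koszulMap x φ) (koszulMap x ψ)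
      (koszulMap_comp_eq_zero x h.linearMap_comp_eq_zero)).ShortExact :=
  HomologicalComplex.shortExact_of_degreewise_shortExact _ fun _ =>
    ModuleCat.shortComplex_shortExact _ (exact_piMap fun _ => h)
      (Function.Injective.piMap fun _ => hφ) (Function.Surjective.piMap fun _ => hψ)

end Functoriality

lemma isSMulRegular_koszul_homology {r : R} (hr : IsSMulRegular M r) {i : ℕ}
    (h : Limits.IsZero ((koszul x (QuotSMulTop r M)).homology (i + 1))) :
    IsSMulRegular ((koszul x M).homology i) r :=
  isSMulRegular_homology_of_shortExact
    (koszulMap_shortExact x (φ := LinearMap.lsmul R M r) hr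
      (LinearMap.exact_lsmul_mkQ_smul_top M r) (Submodule.mkQ_surjective _))
    fun k hk => by
      obtain rfl : i + 1 = k := hk
      exact h

lemma isZero_koszul_homology_of_isWeaklyRegular {ys : List R}
    (hys : ∀ y ∈ ys, y ∈ Ideal.span (Set.range x))
    (hreg : RingTheory.Sequence.IsWeaklyRegular M ys) {i : ℕ} (hi : l < i + ys.length) :
    Limits.IsZero ((koszul x M).homology i) := by
  induction ys generalizing M i with
  | nil =>
    have : IsEmpty (Idx l i) := ⟨fun S => by
      have := S.1.card_le_univ
      rw [S.2, Fintype.card_fin] at this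
      exact hi.not_ge this⟩
    refine ShortComplex.isZero_homology_of_isZero_X₂ _ ?_
    exact ModuleCat.isZero_iff_subsingleton.mpr (inferInstanceAs (Subsingleton (Idx l i → M)))
  | cons y ys ih =>
    rw [RingTheory.Sequence.isWeaklyRegular_cons_iff] at hreg
    rw [List.forall_mem_cons] at hys
    refine isZero_of_isSMulRegular
      (isSMulRegular_koszul_homology x hreg.1 (ih hys.2 hreg.2 (by grind))) fun z => ⟨1, ?_⟩
    rw [pow_one]
    exact Module.mem_annihilator.mp (span_range_le_annihilator_koszul_homology x M i hys.1) z

lemma isZero_koszul_homology_succ_iff {i : ℕ} :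
    Limits.IsZero ((koszul x M).homology (i + 1)) ↔
      Function.Exact (koszulD x M (i + 1)) (koszulD x M i) := by
  rw [← HomologicalComplex.exactAt_iff_isZero_homology,
    HomologicalComplex.exactAt_iff' _ (i + 1 + 1) (i + 1) i (by simp) (by simp),
    ShortComplex.ShortExact.moduleCat_exact_iff_function_exact]
  simp only [HomologicalComplex.sc', HomologicalComplex.shortComplexFunctor', koszul_d]
  rfl

lemma mem_span_range_smul_top_iff {ι : Type*} [Fintype ι] {y : ι → R} {m : M} :
    m ∈ Ideal.span (Set.range y) • (⊤ : Submodule R M) ↔ ∃ n : ι → M, ∑ j, y j • n j = m := by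
  refine ⟨fun hm => ?_, ?_⟩
  · rw [Submodule.span_smul_eq, Submodule.set_smul_eq_iSup, iSup_range, ← iSup_univ,
      ← Finset.coe_univ] at hm
    obtain ⟨μ, rfl⟩ := (Submodule.mem_iSup_finset_iff_exists_sum _ _).mp hm
    choose n hn using fun j => (Submodule.mem_smul_pointwise_iff_exists _ _ _).mp (μ j).2
    exact ⟨n, Finset.sum_congr rfl fun j _ => (hn j).2⟩
  · rintro ⟨n, rfl⟩
    exact sum_mem fun j _ => Submodule.smul_mem_smul (Ideal.subset_span ⟨j, rfl⟩) trivial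

lemma koszulD_zero_apply (f : Idx l 1 → M) (S : Idx l 0) :
    koszulD x M 0 f S = ∑ j, x j • f ⟨{j}, Finset.card_singleton j⟩ := by
  obtain ⟨S, hS⟩ := S
  obtain rfl := Finset.card_eq_zero.mp hS
  rw [koszulD_apply_eq_sum_zsmul]
  refine Fintype.sum_equiv (Equiv.subtypeUnivEquiv Finset.notMem_empty) _ _ fun j => ?_
  exact (one_smul ℤ _)

lemma koszulD_apply_mem (i : ℕ) (f : Idx l (i + 1) → M) (S : Idx l i) :
    koszulD x M i f S ∈
      Ideal.span (Set.range fun j : {j // j ∉ S.1} => x j.1) • (⊤ : Submodule R M) := by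
  simp only [koszulD_apply, smul_comm _ (x _)]
  exact mem_span_range_smul_top_iff.mpr ⟨_, rfl⟩

variable {x}

lemma mem_span_smul_top_of_isZero_koszul_homology_one
    (h : Limits.IsZero ((koszul x M).homology 1)) {n : Fin l → M} (hn : ∑ j, x j • n j = 0)
    (a : Fin l) :
    n a ∈ Ideal.span (Set.range fun j : {j // j ≠ a} => x j.1) • (⊤ : Submodule R M) := by
  let f : Idx l 1 → M := fun S => ∑ j ∈ S.1, n j
  have hf (j : Fin l) : f ⟨{j}, Finset.card_singleton j⟩ = n j := Finset.sum_singleton n j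
  obtain ⟨g, hg⟩ := ((isZero_koszul_homology_succ_iff x).mp h f).mp <| funext fun S => by
    rw [koszulD_zero_apply, Pi.zero_apply, ← hn]
    exact Finset.sum_congr rfl fun j _ => congrArg (x j • ·) (hf j)
  have := koszulD_apply_mem x 1 g ⟨{a}, Finset.card_singleton a⟩
  rw [hg, hf] at this
  refine Submodule.smul_mono_left (Ideal.span_mono ?_) this
  rintro _ ⟨j, rfl⟩
  exact ⟨⟨j.1, Finset.notMem_singleton.mp j.2⟩, rfl⟩

lemma mem_span_smul_top_of_smul_mem (h : Limits.IsZero ((koszul x M).homology 1)) {a : Fin l}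
    {m : M} (hm : x a • m ∈
      Ideal.span (Set.range fun j : {j // j ≠ a} => x j.1) • (⊤ : Submodule R M)) :
    m ∈ Ideal.span (Set.range fun j : {j // j ≠ a} => x j.1) • (⊤ : Submodule R M) := by
  obtain ⟨n, hn⟩ := mem_span_range_smul_top_iff.mp hm
  let n' : Fin l → M := fun j => if h : j = a then -m else n ⟨j, h⟩
  have hn' : ∑ j, x j • n' j = 0 := by
    rw [Fintype.sum_eq_add_sum_subtype_ne _ a]
    simp [n', hn, fun j : {j // j ≠ a} => j.2]
  simpa [n'] using mem_span_smul_top_of_isZero_koszul_homology_one h hn' a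

lemma span_range_smul_top_eq_top_of_isZero_koszul_homology_zero
    (h : Limits.IsZero ((koszul x M).homology 0)) :
    Ideal.span (Set.range x) • (⊤ : Submodule R M) = ⊤ := by
  rw [← HomologicalComplex.exactAt_iff_isZero_homology,
    HomologicalComplex.exactAt_iff' _ 1 0 0 (by simp) (by simp)] at h
  have hepi : Epi ((koszul x M).d 1 0) := h.epi_f ((koszul x M).shape 0 0 (by simp))
  rw [koszul_d] at hepi
  have hsurj : Function.Surjective (koszulD x M 0) := (ModuleCat.epi_iff_surjective _).mp hepi
  refine eq_top_iff.mpr fun m _ => ?_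
  obtain ⟨g, hg⟩ := hsurj fun _ => m
  have hmem := koszulD_apply_mem x 0 g ⟨∅, Finset.card_empty⟩
  rw [hg] at hmem
  exact Submodule.smul_mono_left (Ideal.span_mono (Set.range_comp_subset_range Subtype.val x)) hmem

variable (x) in
lemma isZero_koszul_homology_of_retract {A N : Type*} [CommRing A] [Algebra R A] [AddCommGroup N]
    [Module R N] [Module A N] [IsScalarTower R A N] {ι : M →ₗ[R] N} {π : N →ₗ[R] M}
    (hπ : π ∘ₗ ι = LinearMap.id) {i : ℕ}
    (h : Limits.IsZero ((koszul (algebraMap R A ∘ x) N).homology (i + 1))) :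
    Limits.IsZero ((koszul x M).homology (i + 1)) := by
  have koszulD_algebraMap (i : ℕ) (f : Idx l (i + 1) → N) :
      koszulD (algebraMap R A ∘ x) N i f = koszulD x N i f := by
    ext S
    simp only [koszulD_apply_eq_sum_zsmul, Function.comp_apply, algebraMap_smul]
  rw [isZero_koszul_homology_succ_iff] at h ⊢
  refine LinearMap.exact_of_comp_eq_zero_of_ker_le_range (koszulD_comp x M i) fun f hf => ?_
  obtain ⟨g, hg⟩ := (h fun S => ι (f S)).mp <| by
    rw [koszulD_algebraMap, koszulD_map, LinearMap.mem_ker.mp hf]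
    exact funext fun _ => map_zero ι
  refine ⟨fun S => π (g S), ?_⟩
  rw [koszulD_map, ← koszulD_algebraMap, hg]
  exact funext fun S => LinearMap.congr_fun hπ (f S)

end Koszul

section Localization

lemma isUnit_algebraMap_of_dvd {R A : Type*} [CommSemiring R] [Semiring A] [Algebra R A] {a b : R}
    (hab : a ∣ b) (hb : IsUnit (algebraMap R A b)) : IsUnit (algebraMap R A a) := by
  obtain ⟨c, rfl⟩ := hab
  have hcomm : Commute (algebraMap R A a) (algebraMap R A c) := Algebra.commutes a _
  rw [map_mul, hcomm.isUnit_mul_iff] at hb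
  exact hb.1

variable {R : Type*} [CommRing R] {M M₁ M₂ : Type*} [AddCommGroup M] [AddCommGroup M₁]
  [AddCommGroup M₂] [Module R M] [Module R M₁] [Module R M₂]

lemma isLocalizedModule_powers_of_comp {x p q : R} {f : M →ₗ[R] M₁} {g : M →ₗ[R] M₂}
    [IsLocalizedModule (.powers q) f] [IsLocalizedModule (.powers p) g] {h : M₁ →ₗ[R] M₂}
    (hfg : h ∘ₗ f = g) (hxp : x ∣ p) (hqp : q ∣ p) (hp : p ∣ x * q) :
    IsLocalizedModule (.powers x) h := by
  obtain ⟨a, ha⟩ := hp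
  have isUnit_of_dvd {b : R} (hb : b ∣ p) (n : ℕ) :
      IsUnit (algebraMap R (Module.End R M₂) (b ^ n)) := by
    rw [map_pow]
    exact (isUnit_algebraMap_of_dvd hb
      (IsLocalizedModule.map_units g ⟨p, Submonoid.mem_powers p⟩)).pow n
  have smul_injective (n : ℕ) : Function.Injective (q ^ n • · : M₂ → M₂) :=
    ((Module.End.isUnit_iff _).mp (isUnit_of_dvd hqp n)).injective
  refine ⟨?_, fun w => ?_, fun {z z'} hz => ?_⟩
  · rintro ⟨_, n, rfl⟩
    exact isUnit_of_dvd hxp n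
  · obtain ⟨⟨m, _, n, rfl⟩, hm : p ^ n • w = g m⟩ := IsLocalizedModule.surj (.powers p) g w
    let s : Submonoid.powers q := ⟨_, n, rfl⟩
    have hs : q ^ n • IsLocalizedModule.mk' f (a ^ n • m) s = f (a ^ n • m) :=
      IsLocalizedModule.mk'_cancel' f _ s
    refine ⟨(IsLocalizedModule.mk' f (a ^ n • m) s, ⟨_, n, rfl⟩), smul_injective n ?_⟩
    change q ^ n • x ^ n • w = q ^ n • h _
    rw [← map_smul h, hs, ← LinearMap.comp_apply, hfg, map_smul, ← hm, smul_smul, smul_smul,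
      ← mul_pow, ← mul_pow, mul_comm, ha, mul_comm]
  · obtain ⟨⟨m, _, n, rfl⟩, hm : q ^ n • (z - z') = f m⟩ :=
      IsLocalizedModule.surj (.powers q) f (z - z')
    have hgm : g m = 0 := by
      rw [← hfg, LinearMap.comp_apply, ← hm, map_smul, map_sub, hz, sub_self, smul_zero]
    obtain ⟨⟨_, N, rfl⟩, hN : p ^ N • m = 0⟩ :=
      (IsLocalizedModule.eq_zero_iff (.powers p) g).mp hgm
    refine ⟨⟨_, N, rfl⟩, sub_eq_zero.mp ?_⟩
    change x ^ N • z - x ^ N • z' = 0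
    refine IsLocalizedModule.smul_injective (S := .powers q) f ⟨_, N + n, rfl⟩ ?_
    change q ^ (N + n) • (x ^ N • z - x ^ N • z') = q ^ (N + n) • (0 : M₁)
    rw [← smul_sub, smul_comm, pow_add, mul_smul, hm, smul_smul, ← mul_pow, ha, mul_comm, mul_pow,
      mul_smul, ← map_smul, hN, map_zero, smul_zero, smul_zero]

end Localization

section Cech

variable {R : Type u} [CommRing R] {l : ℕ} (x : Fin l → R)
variable (M : Type v) [AddCommGroup M] [Module R M]

instance isLocalizedModule_locMap_insert (S : Finset (Fin l)) (j : Fin l) :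
    IsLocalizedModule (Submonoid.powers (x j)) (locMap x M (Finset.subset_insert j S)) := by
  refine isLocalizedModule_powers_of_comp (locMap_mk x M _)
    (Finset.dvd_prod_of_mem x (Finset.mem_insert_self j S))
    (Finset.prod_dvd_prod_of_subset _ _ x (Finset.subset_insert j S)) ?_
  by_cases hj : j ∈ S
  · rw [Finset.insert_eq_of_mem hj]
    exact dvd_mul_left _ _
  · rw [Finset.prod_insert hj]

variable {M} in
lemma locMap_locMap {S T U : Finset (Fin l)} (h : S ⊆ T) (h' : T ⊆ U) (z : LocAt x M S) :
    locMap x M h' (locMap x M h z) = locMap x M (h.trans h') z :=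
  LinearMap.congr_fun (locMap_comp x M h h') z

/-- The localization at `x_j` of the degree `i` term of the Čech complex; the component at `S` is
`M_{x_S} → M_{x_{S ∪ {j}}}`. -/
def cechInvert (j : Fin l) (i : ℕ) :
    (∀ S : Idx l i, LocAt x M S.1) →ₗ[R] (∀ S : Idx l i, LocAt x M (insert j S.1)) :=
  .pi fun S => locMap x M (Finset.subset_insert j S.1) ∘ₗ .proj S

instance isLocalizedModule_cechInvert (j : Fin l) (i : ℕ) :
    IsLocalizedModule (Submonoid.powers (x j)) (cechInvert x M j i) := by
  unfold cechInvert
  infer_instance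

variable {M}

/-- The contraction of the localization of the Čech complex at `x_j`, written on chains of the
Čech complex itself. -/
def cechContraction (j : Fin l) {i : ℕ} (f : ∀ S : Idx l (i + 1), LocAt x M S.1) (S : Idx l i) :
    LocAt x M (insert j S.1) :=
  if h : j ∈ S.1 then 0
  else sgn S.1 j • locMap x M (Finset.Subset.refl (insert j S.1)) (f (S.insert ⟨j, h⟩))

lemma locMap_cechD_apply {i : ℕ} (f : ∀ S : Idx l i, LocAt x M S.1) (S : Idx l (i + 1))
    {U : Finset (Fin l)} (h : S.1 ⊆ U) :
    locMap x M h (cechD x M i f S) = ∑ j : {j // j ∈ S.1},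
      sgn S.1 j.1 • locMap x M ((S.erase_subset j).trans h) (f (S.erase j)) := by
  rw [cechD_apply, map_sum]
  refine Finset.sum_congr rfl fun j _ => ?_
  rw [Int.cast_smul_eq_zsmul, map_zsmul, locMap_locMap]

lemma cechInvert_cechD_apply (j : Fin l) {i : ℕ} (g : ∀ S : Idx l i, LocAt x M S.1)
    (T : Idx l (i + 1)) :
    cechInvert x M j (i + 1) (cechD x M i g) T = ∑ k : {k // k ∈ T.1}, sgn T.1 k.1 •
      locMap x M (Finset.insert_subset_insert j (T.erase_subset k))
        (cechInvert x M j i g (T.erase k)) := by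
  refine (locMap_cechD_apply x g T (Finset.subset_insert j T.1)).trans ?_
  refine Finset.sum_congr rfl fun k _ => ?_
  exact congrArg _ (locMap_locMap x (Finset.subset_insert j _) _ _).symm

lemma locMap_cechContraction_of_mem {i : ℕ} {j : Fin l} (f : ∀ S : Idx l (i + 1), LocAt x M S.1)
    {S : Idx l i} (hj : j ∈ S.1) {U : Finset (Fin l)} (h : insert j S.1 ⊆ U) :
    locMap x M h (cechContraction x j f S) = 0 := by
  rw [cechContraction, dif_pos hj, map_zero]

lemma locMap_cechContraction_of_notMem {i : ℕ} {j : Fin l}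
    (f : ∀ S : Idx l (i + 1), LocAt x M S.1) {S : Idx l i} (hj : j ∉ S.1) {T : Idx l (i + 1)}
    (hT : T.1 = insert j S.1) {U : Finset (Fin l)} (h : insert j S.1 ⊆ U) (h' : T.1 ⊆ U) :
    locMap x M h (cechContraction x j f S) = sgn S.1 j • locMap x M h' (f T) := by
  obtain rfl : T = S.insert ⟨j, hj⟩ := Subtype.ext hT
  rw [cechContraction, dif_neg hj, map_zsmul]
  exact congrArg _ (locMap_locMap x _ _ _)

lemma cechInvert_apply_of_cechD_eq_zero {i : ℕ} {j : Fin l} {f : ∀ S : Idx l i, LocAt x M S.1}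
    (hf : cechD x M i f = 0) (T : Idx l i) (hj : j ∉ T.1) :
    cechInvert x M j i f T = -∑ k : {k // k ∈ T.1}, (sgn T.1 j * sgn (insert j T.1) k.1) •
      locMap x M (T.erase_insert_subset hj (Idx.mem_insert_of_mem k.2))
        (f ((T.insert ⟨j, hj⟩).erase ⟨k.1, Idx.mem_insert_of_mem k.2⟩)) := by
  have hsum : sgn T.1 j • cechInvert x M j i f T + ∑ k : {k // k ∈ T.1},
      sgn (insert j T.1) k.1 • locMap x M (T.erase_insert_subset hj (Idx.mem_insert_of_mem k.2))
        (f ((T.insert ⟨j, hj⟩).erase ⟨k.1, Idx.mem_insert_of_mem k.2⟩)) = 0 := by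
    have h := locMap_cechD_apply x f (T.insert ⟨j, hj⟩) (Finset.Subset.refl (insert j T.1))
    have hsgn : sgn (T.insert ⟨j, hj⟩).1 j = sgn T.1 j := sgn_insert_self hj
    rw [hf, Pi.zero_apply, map_zero, T.sum_mem_insert ⟨j, hj⟩, hsgn,
      locMap_congr x M f (T.erase_insert ⟨j, hj⟩) _ (Finset.subset_insert j T.1)] at h
    exact h.symm
  simp only [mul_smul, Finset.sum_zsmul]
  rw [← zsmul_neg, ← eq_neg_of_add_eq_zero_left hsum, smul_smul, sgn_mul_self, one_smul]

lemma sum_locMap_cechContraction {i : ℕ} (j : Fin l) {f : ∀ S : Idx l (i + 1), LocAt x M S.1}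
    (hf : cechD x M (i + 1) f = 0) (T : Idx l (i + 1)) :
    ∑ k : {k // k ∈ T.1}, sgn T.1 k.1 •
      locMap x M (Finset.insert_subset_insert j (T.erase_subset k))
        (cechContraction x j f (T.erase k)) = cechInvert x M j (i + 1) f T := by
  by_cases hj : j ∈ T.1
  · rw [Fintype.sum_eq_single ⟨j, hj⟩ fun k hk => ?_]
    · have hsgn : sgn (T.erase ⟨j, hj⟩).1 j = sgn T.1 j :=
        (sgn_insert_self (Finset.notMem_erase j T.1)).symm.trans
          (congrArg (sgn · j) (Finset.insert_erase hj))
      rw [locMap_cechContraction_of_notMem x f (Finset.notMem_erase j T.1)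
        (Finset.insert_erase hj).symm _ (Finset.subset_insert j T.1), hsgn, smul_smul,
        sgn_mul_self, one_smul]
      rfl
    · have hjk : j ∈ (T.erase k).1 :=
        Finset.mem_erase.mpr ⟨fun h => hk (Subtype.ext h.symm), hj⟩
      exact (congrArg (sgn T.1 k.1 • ·) (locMap_cechContraction_of_mem x f hjk _)).trans
        (zsmul_zero _)
  · rw [cechInvert_apply_of_cechD_eq_zero x hf T hj, ← Finset.sum_neg_distrib]
    refine Finset.sum_congr rfl fun k _ => ?_
    have hjk : j ∉ (T.erase k).1 := fun h => hj (T.erase_subset k h)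
    have hkj : j ≠ k.1 := fun h => hj (h ▸ k.2)
    have hT : ((T.insert ⟨j, hj⟩).erase ⟨k.1, Idx.mem_insert_of_mem k.2⟩).1 =
        insert j (T.erase k).1 := Finset.erase_insert_of_ne hkj
    rw [locMap_cechContraction_of_notMem x f hjk hT _
      (T.erase_insert_subset hj (Idx.mem_insert_of_mem k.2)),
      ← neg_smul, ← sgn_mul_sgn_erase hj k.2, mul_smul]
    rfl

lemma exists_pow_smul_mem_range_cechD (j : Fin l) {i : ℕ}
    {f : ∀ S : Idx l (i + 1), LocAt x M S.1} (hf : cechD x M (i + 1) f = 0) :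
    ∃ n : ℕ, x j ^ n • f ∈ LinearMap.range (cechD x M i) := by
  obtain ⟨⟨g, _, n, rfl⟩, hg⟩ := IsLocalizedModule.surj (.powers (x j)) (cechInvert x M j i)
    (cechContraction x j f)
  replace hg : x j ^ n • cechContraction x j f = cechInvert x M j i g := hg
  have hdg : cechInvert x M j (i + 1) (cechD x M i g) =
      cechInvert x M j (i + 1) (x j ^ n • f) := by
    ext T
    rw [cechInvert_cechD_apply, map_smul, Pi.smul_apply, ← sum_locMap_cechContraction x j hf,
      ← hg, Finset.smul_sum]
    refine Finset.sum_congr rfl fun k _ => ?_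
    rw [Pi.smul_apply, map_smul, smul_comm]
  obtain ⟨⟨_, N, rfl⟩, hN⟩ := IsLocalizedModule.exists_of_eq (S := .powers (x j)) hdg
  replace hN : x j ^ N • cechD x M i g = x j ^ N • x j ^ n • f := hN
  exact ⟨N + n, x j ^ N • g, by rw [map_smul, hN, smul_smul, pow_add]⟩

lemma exists_pow_smul_eq_zero_of_cechD_zero_eq_zero (j : Fin l) {f : ∀ S : Idx l 0, LocAt x M S.1}
    (hf : cechD x M 0 f = 0) : ∃ n : ℕ, x j ^ n • f = 0 := by
  have h : cechInvert x M j 0 f = 0 := funext fun T => by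
    have hT : T.1 = ∅ := Finset.card_eq_zero.mp T.2
    have : IsEmpty {k // k ∈ T.1} := ⟨fun k => Finset.notMem_empty k.1 (hT ▸ k.2)⟩
    rw [cechInvert_apply_of_cechD_eq_zero x hf T (by simp [hT]), Fintype.sum_empty, neg_zero]
    rfl
  obtain ⟨⟨_, n, rfl⟩, hn⟩ := (IsLocalizedModule.eq_zero_iff (.powers (x j)) _).mp h
  exact ⟨n, hn⟩

variable (M) in
lemma cech_d (i : ℕ) : (cech x M).d i (i + 1) = ModuleCat.ofHom (cechD x M i) := by
  simp only [cech, CochainComplex.of_d]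

lemma exists_pow_smul_cech_homology_eq_zero (j : Fin l) (i : ℕ) (z : (cech x M).homology i) :
    ∃ n : ℕ, x j ^ n • z = 0 := by
  suffices ∀ k, (h : (ComplexShape.up ℕ).prev i = k) →
      ∀ f : (cech x M).X i, (cech x M).d i (i + 1) f = 0 →
        ∃ n : ℕ, x j ^ n • f ∈ LinearMap.range ((cech x M).d k i).hom by
    let e := ((cech x M).homologyIsoSc' _ i (i + 1) rfl (by simp)).toLinearEquiv
    obtain ⟨n, hn⟩ := exists_pow_smul_homology_eq_zero _ (this _ rfl) (e z)
    exact ⟨n, e.map_eq_zero_iff.mp ((map_smul e _ _).trans hn)⟩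
  rintro k rfl f hf
  rw [cech_d] at hf
  obtain _ | i := i
  · obtain ⟨n, hn⟩ := exists_pow_smul_eq_zero_of_cechD_zero_eq_zero x j hf
    exact ⟨n, hn ▸ zero_mem _⟩
  · rw [CochainComplex.prev_nat_succ, cech_d]
    exact exists_pow_smul_mem_range_cechD x j hf

section Functoriality

variable {N P : Type v} [AddCommGroup N] [Module R N] [AddCommGroup P] [Module R P]

/-- The map `M_{x_S} → N_{x_S}` obtained by localizing a linear map `M → N`. -/
def locAtMap (φ : M →ₗ[R] N) (S : Finset (Fin l)) : LocAt x M S →ₗ[R] LocAt x N S :=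
  IsLocalizedModule.map (.powers (∏ j ∈ S, x j)) (LocalizedModule.mkLinearMap _ M)
    (LocalizedModule.mkLinearMap _ N) φ

lemma locMap_comp_locAtMap (φ : M →ₗ[R] N) {S T : Finset (Fin l)} (h : S ⊆ T) :
    locMap x N h ∘ₗ locAtMap x φ S = locAtMap x φ T ∘ₗ locMap x M h := by
  refine IsLocalizedModule.ext (.powers (∏ j ∈ S, x j)) (LocalizedModule.mkLinearMap _ M)
    (isUnit_locAt x N h) ?_
  rw [LinearMap.comp_assoc, LinearMap.comp_assoc, locMap_mk, locAtMap, IsLocalizedModule.map_comp,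
    ← LinearMap.comp_assoc, locMap_mk, locAtMap, IsLocalizedModule.map_comp]

lemma cechD_map (φ : M →ₗ[R] N) {i : ℕ} (f : ∀ S : Idx l i, LocAt x M S.1) :
    cechD x N i (fun S : Idx l i => locAtMap x φ S.1 (f S)) =
      fun S : Idx l (i + 1) => locAtMap x φ S.1 (cechD x M i f S) := by
  ext S
  rw [cechD_apply, cechD_apply, map_sum]
  refine Finset.sum_congr rfl fun j _ => ?_
  rw [map_smul]
  exact congrArg _ (LinearMap.congr_fun (locMap_comp_locAtMap x φ (S.erase_subset j)) _)

/-- The cochain map `C(x; M) ⟶ C(x; N)` induced by a linear map `M → N`. -/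
def cechMap (φ : M →ₗ[R] N) : cech x M ⟶ cech x N :=
  CochainComplex.ofHom
    (fun i => ModuleCat.ofHom (LinearMap.piMap fun S : Idx l i => locAtMap x φ S.1)) fun i => by
    rw [cech_d, cech_d]
    exact ModuleCat.hom_ext (LinearMap.ext (cechD_map x φ))

lemma cechMap_lsmul (r : R) : cechMap x (LinearMap.lsmul R M r) = r • 𝟙 (cech x M) := by
  have locAtMap_lsmul (S : Finset (Fin l)) :
      locAtMap x (LinearMap.lsmul R M r) S = r • LinearMap.id := by
    have hr : LinearMap.lsmul R M r = r • LinearMap.id := rfl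
    rw [locAtMap, hr, map_smul, IsLocalizedModule.map_id]
  ext i : 1
  exact ModuleCat.hom_ext (LinearMap.ext fun f => funext fun S =>
    LinearMap.congr_fun (locAtMap_lsmul S.1) (f S))

lemma cechMap_comp_eq_zero {φ : M →ₗ[R] N} {ψ : N →ₗ[R] P} (h : ψ ∘ₗ φ = 0) :
    cechMap x φ ≫ cechMap x ψ = 0 := by
  have locAtMap_comp (S : Finset (Fin l)) : locAtMap x ψ S ∘ₗ locAtMap x φ S = 0 := by
    rw [locAtMap, locAtMap, ← IsLocalizedModule.map_comp', h, map_zero]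
  ext i : 1
  exact ModuleCat.hom_ext (LinearMap.ext fun f => funext fun S =>
    LinearMap.congr_fun (locAtMap_comp S.1) (f S))

lemma cechMap_shortExact {φ : M →ₗ[R] N} {ψ : N →ₗ[R] P} (hφ : Function.Injective φ)
    (h : Function.Exact φ ψ) (hψ : Function.Surjective ψ) :
    (ShortComplex.mk (cechMap x φ) (cechMap x ψ)
      (cechMap_comp_eq_zero x h.linearMap_comp_eq_zero)).ShortExact :=
  HomologicalComplex.shortExact_of_degreewise_shortExact _ fun _ =>
    ModuleCat.shortComplex_shortExact _
      (exact_piMap fun _ => IsLocalizedModule.map_exact _ _ _ _ _ _ h)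
      (Function.Injective.piMap fun _ => IsLocalizedModule.map_injective _ _ _ _ hφ)
      (Function.Surjective.piMap fun _ => IsLocalizedModule.map_surjective _ _ _ _ hψ)

end Functoriality

open scoped Pointwise in
lemma cechMap_lsmul_shortExact {r : R} (hr : IsSMulRegular M r) :
    (ShortComplex.mk (cechMap x (LinearMap.lsmul R M r)) (cechMap x (r • (⊤ : Submodule R M)).mkQ)
      (cechMap_comp_eq_zero x
        (LinearMap.exact_lsmul_mkQ_smul_top M r).linearMap_comp_eq_zero)).ShortExact :=
  cechMap_shortExact x (φ := LinearMap.lsmul R M r) hr (LinearMap.exact_lsmul_mkQ_smul_top M r)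
    (Submodule.mkQ_surjective _)

lemma isSMulRegular_cech_homology {r : R} (hr : IsSMulRegular M r) {i : ℕ}
    (h : ∀ k, k + 1 = i → Limits.IsZero ((cech x (QuotSMulTop r M)).homology k)) :
    IsSMulRegular ((cech x M).homology i) r := by
  have hse := cechMap_lsmul_shortExact x hr
  simp only [cechMap_lsmul] at hse
  exact isSMulRegular_homology_of_shortExact hse h

lemma isZero_cech_homology_quotSMulTop {r : R} (hr : IsSMulRegular M r) {i : ℕ}
    (hi : Limits.IsZero ((cech x M).homology i))
    (hi' : Limits.IsZero ((cech x M).homology (i + 1))) :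
    Limits.IsZero ((cech x (QuotSMulTop r M)).homology i) :=
  isZero_homology_X₃_of_shortExact (cechMap_lsmul_shortExact x hr) rfl hi hi'

lemma isZero_cech_homology_of_isWeaklyRegular {ys : List R} (hys : ∀ y ∈ ys, y ∈ Set.range x)
    (hreg : RingTheory.Sequence.IsWeaklyRegular M ys) {i : ℕ} (hi : i < ys.length) :
    Limits.IsZero ((cech x M).homology i) := by
  induction ys generalizing M i with
  | nil => exact absurd hi i.not_lt_zero
  | cons y ys ih =>
    rw [RingTheory.Sequence.isWeaklyRegular_cons_iff] at hreg
    rw [List.forall_mem_cons] at hys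
    obtain ⟨⟨j, rfl⟩, hys⟩ := hys
    exact isZero_of_isSMulRegular
      (isSMulRegular_cech_homology x hreg.1 fun k hk => ih hys hreg.2 (by grind))
      (exists_pow_smul_cech_homology_eq_zero x j i)

lemma cechD_zero_injective (h : Limits.IsZero ((cech x M).homology 0)) :
    Function.Injective (cechD x M 0) := by
  rw [← HomologicalComplex.exactAt_iff_isZero_homology,
    HomologicalComplex.exactAt_iff' _ 0 0 1 (by simp) (by simp)] at h
  have hmono : Mono ((cech x M).d 0 1) := h.mono_g ((cech x M).shape 0 0 (by simp))
  rw [cech_d] at hmono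
  exact (ModuleCat.mono_iff_injective _).mp hmono

variable {x}

lemma mkLinearMap_eq_zero_of_smul_eq_zero {m : M} {S : Finset (Fin l)} {j : Fin l} (hj : j ∈ S)
    (hm : x j • m = 0) :
    LocalizedModule.mkLinearMap (.powers (∏ k ∈ S, x k)) M m = 0 := by
  refine (IsLocalizedModule.eq_zero_iff (.powers (∏ k ∈ S, x k)) _).mpr
    ⟨⟨_, Submonoid.mem_powers _⟩, ?_⟩
  change (∏ k ∈ S, x k) • m = 0
  rw [← Finset.prod_erase_mul S x hj, mul_smul, hm, smul_zero]

lemma eq_zero_of_isZero_cech_homology_zero (h : Limits.IsZero ((cech x M).homology 0)) {m : M}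
    (hm : ∀ j, x j • m = 0) : m = 0 := by
  let f (S : Idx l 0) : LocAt x M S.1 := LocalizedModule.mkLinearMap _ M m
  have hf : cechD x M 0 f = 0 := by
    ext S
    rw [cechD_apply]
    refine Finset.sum_eq_zero fun j _ => ?_
    have hj : locMap x M (S.erase_subset j) (f (S.erase j)) = 0 :=
      (LinearMap.congr_fun (locMap_mk x M (S.erase_subset j)) m).trans
        (mkLinearMap_eq_zero_of_smul_eq_zero j.2 (hm j))
    rw [hj, smul_zero]
  have hf0 : f = 0 := cechD_zero_injective x h (hf.trans (map_zero _).symm)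
  obtain ⟨⟨_, n, rfl⟩, hn : (∏ j ∈ ∅, x j) ^ n • m = 0⟩ :=
    (IsLocalizedModule.eq_zero_iff (.powers (∏ j ∈ ∅, x j)) _).mp (congrFun hf0 ⟨∅, rfl⟩)
  rwa [Finset.prod_empty, one_pow, one_smul] at hn

lemma quotient_eq_zero_of_isZero_cech_homology {ys : List R}
    (hreg : RingTheory.Sequence.IsWeaklyRegular M ys)
    (h : ∀ i ≤ ys.length, Limits.IsZero ((cech x M).homology i))
    {z : M ⧸ (Ideal.ofList ys • ⊤ : Submodule R M)} (hz : ∀ j, x j • z = 0) : z = 0 := by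
  induction ys generalizing M with
  | nil =>
    let e := Submodule.quotEquivOfEqBot (Ideal.ofList ([] : List R) • ⊤ : Submodule R M)
      (by rw [Ideal.ofList_nil, Submodule.bot_smul])
    refine e.map_eq_zero_iff.mp (eq_zero_of_isZero_cech_homology_zero (h 0 le_rfl) fun j => ?_)
    rw [← map_smul, hz, map_zero]
  | cons y ys ih =>
    rw [RingTheory.Sequence.isWeaklyRegular_cons_iff] at hreg
    let e := Submodule.quotOfListConsSMulTopEquivQuotSMulTopInner M y ys
    have hquot (i : ℕ) (hi : i ≤ ys.length) :
        Limits.IsZero ((cech x (QuotSMulTop y M)).homology i) :=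
      isZero_cech_homology_quotSMulTop x hreg.1 (h i (Nat.le_succ_of_le hi))
        (h (i + 1) (Nat.succ_le_succ hi))
    refine e.map_eq_zero_iff.mp (ih hreg.2 hquot fun j => ?_)
    rw [← map_smul, hz, map_zero]

end Cech

section Grade

variable {R : Type u} [CommRing R] {M : Type v} [AddCommGroup M] [Module R M]

lemma le_classicalGrade {I : Ideal R} {ys : List R} (h : ∀ y ∈ ys, y ∈ I)
    (hreg : RingTheory.Sequence.IsWeaklyRegular M ys) : (ys.length : ℕ∞) ≤ classicalGrade M I :=
  le_iSup₂ (f := fun (ys : List R) (_ : (∀ r ∈ ys, r ∈ I) ∧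
    RingTheory.Sequence.IsWeaklyRegular M ys) => (ys.length : ℕ∞)) ys ⟨h, hreg⟩

lemma exists_isWeaklyRegular_of_le_classicalGrade {I : Ideal R} {n : ℕ}
    (h : (n : ℕ∞) ≤ classicalGrade M I) :
    ∃ ys : List R, (∀ y ∈ ys, y ∈ I) ∧ RingTheory.Sequence.IsWeaklyRegular M ys ∧
      n ≤ ys.length := by
  obtain _ | n := n
  · exact ⟨[], by simp, .nil R M, le_rfl⟩
  have hlt : (n : ℕ∞) < classicalGrade M I := lt_of_lt_of_le (mod_cast n.lt_succ_self) h
  simp only [classicalGrade, lt_iSup_iff] at hlt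
  obtain ⟨ys, ⟨hmem, hreg⟩, hlen⟩ := hlt
  exact ⟨ys, hmem, hreg, mod_cast hlen⟩

lemma ofList_eq_span_range_get (xs : List R) :
    Ideal.ofList xs = Ideal.span (Set.range xs.get) := by
  rw [Set.range_list_get, Ideal.ofList]

lemma classicalGrade_ofList_le {xs : List R} (h : Ideal.ofList xs • (⊤ : Submodule R M) ≠ ⊤) :
    classicalGrade M (Ideal.ofList xs) ≤ xs.length := by
  refine iSup₂_le fun ys ⟨hmem, hreg⟩ => Nat.cast_le.mpr ?_
  by_contra! hlt
  rw [ofList_eq_span_range_get] at h hmem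
  exact h <| span_range_smul_top_eq_top_of_isZero_koszul_homology_zero <|
    isZero_koszul_homology_of_isWeaklyRegular xs.get hmem hreg (by omega)

lemma classicalGrade_ofList_eq_length {xs : List R}
    (h : Ideal.ofList xs • (⊤ : Submodule R M) ≠ ⊤)
    (hreg : RingTheory.Sequence.IsWeaklyRegular M xs) :
    classicalGrade M (Ideal.ofList xs) = xs.length :=
  le_antisymm (classicalGrade_ofList_le h)
    (le_classicalGrade (fun _ hy => Ideal.subset_span hy) hreg)

lemma classicalGrade_map_ofList_eq_length (A : Type*) [CommRing A] [Algebra R A]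
    [Module.FaithfullyFlat R A] {xs : List R} (h : Ideal.ofList xs • (⊤ : Submodule R M) ≠ ⊤)
    (hg : classicalGrade M (Ideal.ofList xs) = xs.length) :
    classicalGrade (A ⊗[R] M) ((Ideal.ofList xs).map (algebraMap R A)) = xs.length := by
  have hA := TensorProduct.isBaseChange R M A
  apply le_antisymm
  · have hne := (hA.map_smul_top_ne_top_iff_of_faithfullyFlat R M _).mpr h
    rw [Ideal.map_ofList] at hne ⊢
    simpa only [List.length_map] using classicalGrade_ofList_le hne
  · obtain ⟨ys, hmem, hreg, hlen⟩ := exists_isWeaklyRegular_of_le_classicalGrade hg.ge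
    have hmem' : ∀ y ∈ ys.map (algebraMap R A), y ∈ (Ideal.ofList xs).map (algebraMap R A) :=
      List.forall_mem_map.mpr fun y hy => Ideal.mem_map_of_mem _ (hmem y hy)
    refine le_trans ?_ (le_classicalGrade hmem' (hreg.of_flat_of_isBaseChange hA))
    rw [List.length_map]
    exact mod_cast hlen

lemma hasPolynomialGrade_ofList_length {xs : List R}
    (h : Ideal.ofList xs • (⊤ : Submodule R M) ≠ ⊤)
    (hg : classicalGrade M (Ideal.ofList xs) = xs.length) :
    HasPolynomialGrade M (Ideal.ofList xs) xs.length := by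
  have : Nontrivial M := by
    by_contra hM
    rw [not_nontrivial_iff_subsingleton] at hM
    exact h (Subsingleton.elim _ _)
  have := Module.nontrivial R M
  exact tendsto_const_nhds.congr fun n =>
    (classicalGrade_map_ofList_eq_length (MvPolynomial (Fin n) R) h hg).symm

lemma HasPolynomialGrade.exists_le_classicalGrade {I : Ideal R} {g : ℕ}
    (h : HasPolynomialGrade M I g) :
    ∃ n, (g : ℕ∞) ≤ classicalGrade (MvPolynomial (Fin n) R ⊗[R] M)
      (I.map (algebraMap R (MvPolynomial (Fin n) R))) := by
  obtain _ | g := g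
  · exact ⟨0, zero_le⟩
  have hlt : (g : ℕ∞) < (g + 1 : ℕ) := mod_cast g.lt_succ_self
  obtain ⟨n, hn⟩ := (h.eventually (lt_mem_nhds hlt)).exists
  exact ⟨n, mod_cast Order.add_one_le_of_lt hn⟩

lemma HasPolynomialGrade.isZero_koszulHomology {xs : List R}
    (h : HasPolynomialGrade M (Ideal.ofList xs) xs.length) {i : ℕ} (hi : 1 ≤ i) :
    Limits.IsZero (koszulHomology M xs i) := by
  obtain ⟨i, rfl⟩ := Nat.exists_eq_add_of_le' hi
  obtain ⟨n, hn⟩ := h.exists_le_classicalGrade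
  obtain ⟨ys, hmem, hreg, hlen⟩ := exists_isWeaklyRegular_of_le_classicalGrade hn
  rw [ofList_eq_span_range_get, Ideal.map_span, ← Set.range_comp] at hmem
  let ρ : MvPolynomial (Fin n) R →ₗ[R] R := (MvPolynomial.aeval (0 : Fin n → R)).toLinearMap
  have hretract : ((TensorProduct.lid R M).toLinearMap ∘ₗ ρ.rTensor M) ∘ₗ
      TensorProduct.mk R (MvPolynomial (Fin n) R) M 1 = LinearMap.id := by
    ext m
    simp [ρ]
  exact isZero_koszul_homology_of_retract xs.get hretract
    (isZero_koszul_homology_of_isWeaklyRegular _ hmem hreg (by omega))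

end Grade

section Regular

variable {R : Type u} [CommRing R] {M : Type v} [AddCommGroup M] [Module R M]

lemma isWeaklyRegular_concat_iff {xs : List R} {r : R} :
    RingTheory.Sequence.IsWeaklyRegular M (xs ++ [r]) ↔
      RingTheory.Sequence.IsWeaklyRegular M xs ∧
        IsSMulRegular (M ⧸ (Ideal.ofList xs • ⊤ : Submodule R M)) r := by
  rw [RingTheory.Sequence.isWeaklyRegular_append_iff,
    RingTheory.Sequence.isWeaklyRegular_singleton_iff]

lemma isWeaklyRegular_of_isZero_koszulHomology_one {xs : List R}
    (h : ∀ ys, ys <+: xs → Limits.IsZero (koszulHomology M ys 1)) :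
    RingTheory.Sequence.IsWeaklyRegular M xs := by
  induction xs using List.reverseRecOn with
  | nil => exact .nil R M
  | append_singleton xs r ih =>
    refine isWeaklyRegular_concat_iff.mpr
      ⟨ih fun ys hys => h ys (hys.trans (xs.prefix_append [r])), ?_⟩
    rw [isSMulRegular_quotient_iff_mem_of_smul_mem]
    let a : Fin (xs ++ [r]).length := ⟨xs.length, by simp⟩
    have ha : (xs ++ [r]).get a = r := by simp [a]
    have hspan : Ideal.span (Set.range fun j : {j // j ≠ a} => (xs ++ [r]).get j.1) =
        Ideal.ofList xs := by
      refine congrArg Ideal.span (Set.Subset.antisymm ?_ fun s hs => ?_)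
      · rintro _ ⟨⟨⟨j, hj⟩, hja⟩, rfl⟩
        have hlt : j < xs.length := by
          rw [List.length_append, List.length_singleton] at hj
          exact (Nat.le_of_lt_succ hj).lt_of_ne fun e => hja (Fin.ext e)
        simp [List.getElem_append_left hlt]
      · obtain ⟨j, hj, rfl⟩ := List.mem_iff_getElem.mp hs
        exact ⟨⟨⟨j, by simp; omega⟩, fun e => hj.ne (congrArg Fin.val e)⟩, by simp [hj]⟩
    rw [← hspan]
    intro m hm
    exact mem_span_smul_top_of_smul_mem (h _ List.prefix_rfl) (by rwa [ha])

lemma isWeaklyRegular_of_isZero_cechCohomology {xs : List R}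
    (h : ∀ ys, ys <+: xs → ∀ i < ys.length, Limits.IsZero (cechCohomology M ys i)) :
    RingTheory.Sequence.IsWeaklyRegular M xs := by
  induction xs using List.reverseRecOn with
  | nil => exact .nil R M
  | append_singleton xs r ih =>
    have hxs := ih fun ys hys => h ys (hys.trans (xs.prefix_append [r]))
    refine isWeaklyRegular_concat_iff.mpr ⟨hxs, ?_⟩
    rw [isSMulRegular_iff_right_eq_zero_of_smul]
    intro z hz
    refine quotient_eq_zero_of_isZero_cech_homology (x := (xs ++ [r]).get) hxs
      (fun i hi => h _ List.prefix_rfl i ?_) fun j => ?_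
    · rw [List.length_append]
      exact Nat.lt_succ_of_le hi
    obtain hj | hj := List.mem_append.mp (List.get_mem (xs ++ [r]) j)
    · obtain ⟨m, rfl⟩ := Submodule.Quotient.mk_surjective _ z
      rw [← Submodule.Quotient.mk_smul, Submodule.Quotient.mk_eq_zero]
      exact Submodule.smul_mem_smul (Ideal.subset_span hj) trivial
    · rwa [List.mem_singleton.mp hj]

lemma IsStrongParameterSequence.of_isPrefix {xs ys : List R} (hys : ys <+: xs)
    (h : IsStrongParameterSequence M xs) : IsStrongParameterSequence M ys := by
  intro i hi hle
  have := h i hi (hle.trans hys.length_le)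
  rwa [← List.take_append_drop ys.length xs, ← List.prefix_iff_eq_take.mp hys,
    List.take_append_of_le_length hle] at this

lemma IsStrongParameterSequence.smul_ne_top [Nontrivial M] {xs : List R}
    (h : IsStrongParameterSequence M xs) : Ideal.ofList xs • (⊤ : Submodule R M) ≠ ⊤ := by
  obtain rfl | hne := eq_or_ne xs []
  · simp [bot_ne_top]
  · have := (h xs.length (List.length_pos_iff.mpr hne) le_rfl).smul_ne_top
    rwa [List.take_length] at this

lemma IsRegularSequence.isWeaklyRegular {xs : List R} (h : IsRegularSequence M xs) :
    RingTheory.Sequence.IsWeaklyRegular M xs := by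
  obtain rfl | h := h
  · exact .nil R M
  · exact h.toIsWeaklyRegular

end Regular

end NonNoethCM

end

open NonNoethCM in
theorem mainTheorem3_general {R : Type*} [CommRing R] {M : Type*} [AddCommGroup M] [Module R M]
    {P : List R → Prop} (of_isPrefix : ∀ ⦃xs ys⦄, ys <+: xs → P xs → P ys)
    (smul_ne_top : ∀ ⦃xs⦄, P xs → Ideal.ofList xs • (⊤ : Submodule R M) ≠ ⊤) :
    List.TFAE [
      ∀ xs, P xs → IsRegularSequence M xs,
      ∀ xs, P xs → classicalGrade M (Ideal.ofList xs) = (xs.length : ℕ∞),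
      ∀ xs, P xs → HasPolynomialGrade M (Ideal.ofList xs) (xs.length : ℕ∞),
      ∀ xs, P xs → ∀ i : ℕ, 1 ≤ i → CategoryTheory.Limits.IsZero (koszulHomology M xs i),
      ∀ xs, P xs → ∀ i : ℕ, i < xs.length →
        CategoryTheory.Limits.IsZero (cechCohomology M xs i)] := by
  tfae_have 1 → 2 := fun h xs hxs =>
    classicalGrade_ofList_eq_length (smul_ne_top hxs) (h xs hxs).isWeaklyRegular
  tfae_have 2 → 3 := fun h xs hxs =>
    hasPolynomialGrade_ofList_length (smul_ne_top hxs) (h xs hxs)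
  tfae_have 3 → 4 := fun h xs hxs _ hi => (h xs hxs).isZero_koszulHomology hi
  tfae_have 4 → 1 := fun h xs hxs => Or.inr
    ⟨isWeaklyRegular_of_isZero_koszulHomology_one fun ys hys =>
      h ys (of_isPrefix hys hxs) 1 le_rfl, (smul_ne_top hxs).symm⟩
  tfae_have 1 → 5 := fun h xs hxs _ hi =>
    isZero_cech_homology_of_isWeaklyRegular xs.get (by simp [Set.range_list_get])
      (h xs hxs).isWeaklyRegular hi
  tfae_have 5 → 1 := fun h xs hxs => Or.inr
    ⟨isWeaklyRegular_of_isZero_cechCohomology fun ys hys => h ys (of_isPrefix hys hxs),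
      (smul_ne_top hxs).symm⟩
  tfae_finish

theorem mainTheorem3 {R : Type*} [CommRing R] {M : Type*} [AddCommGroup M] [Module R M]
    [Nontrivial M] :
    List.TFAE [
      NonNoethCM.IsCohenMacaulay R M,
      ∀ xs : List R, NonNoethCM.IsStrongParameterSequence M xs →
        NonNoethCM.classicalGrade M (Ideal.ofList xs) = (xs.length : ℕ∞),
      ∀ xs : List R, NonNoethCM.IsStrongParameterSequence M xs →
        NonNoethCM.HasPolynomialGrade M (Ideal.ofList xs) (xs.length : ℕ∞),
      ∀ xs : List R, NonNoethCM.IsStrongParameterSequence M xs →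
        ∀ i : ℕ, 1 ≤ i → CategoryTheory.Limits.IsZero (NonNoethCM.koszulHomology M xs i),
      ∀ xs : List R, NonNoethCM.IsStrongParameterSequence M xs →
        ∀ i : ℕ, i < xs.length →
          CategoryTheory.Limits.IsZero (NonNoethCM.cechCohomology M xs i)] :=
  mainTheorem3_general (fun _ _ => NonNoethCM.IsStrongParameterSequence.of_isPrefix)
    fun _ => NonNoethCM.IsStrongParameterSequence.smul_ne_top
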